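/- Let $n\ge 0$ and let $w=w_1w_2\cdots w_n\in S_n$ be a permutation of $\{1,\dots,n\}$ in one-line notation. For a word $u$ of distinct positive integers let $P(u)$ be its RSK (Schensted row) insertion tableau; in a tableau the first row is the longest row, and the reading word is the concatenation of the rows from the last row to the first. For a standard tableau $T$ with reading word $uu'$, where $u'$ is the first row of $T$, put $K(T)=P(u'u)$ (catabolism), and let $d(T)$ be the largest $m\geq 0$ such that the first row of $T$ contains $1,2,\dots,m$. The catabolizability type of $T$ is the sequence \[\operatorname{ctype}(T)=\bigl(d(T),\,d(K(T))-d(T),\,\dots,\,d(K^{i}(T))-d(K^{i-1}(T)),\,\dots\bigr),\] and $\operatorname{ctype}(w):=\operatorname{ctype}(P(w))$. Write $\mu\unrhd\lambda$ (dominance order) if $\mu_1+\cdots+\mu_k\ge\lambda_1+\cdots+\lambda_k$ for all $k$. **Proposition.** Let $w\in S_n$ and let $1\le i<n$ be an index with $w_i+1<w_{i+1}$. Let $\tilde w=w_1\cdots w_{i-1}\,w_{i+1}\,w_i\,w_{i+2}\cdots w_n$ be obtained from $w$ by swapping the entries in positions $i$ and $i+1$. Then $\operatorname{ctype}(\tilde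 w)\unrhd\operatorname{ctype}(w)$. -/

import Mathlib

namespace Catabolism

/-- A tableau, given as the list of its rows, the first (longest) row coming first; in French
notation this is the bottom row. Each row is listed from left to right. -/
abbrev Tableau : Type := List (List ℕ)

/-- Schensted row insertion of a letter `x` into a single row. If some entry is larger than `x`,
the leftmost such entry is replaced by `x` and is returned as the bumped letter; otherwise `x` is
appended at the right end of the row and nothing is bumped. -/
def rowInsert (x : ℕ) : List ℕ → List ℕ × Option ℕ
  | [] => ([x], none)
  | y :: r =>
    if x < y then (x :: r, some y)
    else (y :: (rowInsert x r).1, (rowInsert x r).2)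

/-- Insertion of a letter into a tableau: insert it into the first row, then insert the bumped
letter (if there is one) into the next row, and so on. -/
def insert : Tableau → ℕ → Tableau
  | [], x => [[x]]
  | r :: T, x =>
    match rowInsert x r with
    | (r', none) => r' :: T
    | (r', some y) => r' :: insert T y

/-- The RSK insertion tableau `P(u)` of a word `u`: insert its letters from left to right. -/
def P (u : List ℕ) : Tableau := u.foldl insert []

/-- The first row of a tableau (empty for the empty tableau). -/
def firstRow (T : Tableau) : List ℕ := T.headD []

/-- The word obtained by concatenating the rows of `T`, from the last row to the first. -/
def readingWord (T : Tableau) : List ℕ := T.reverse.flatten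

/-- Catabolism. If the reading word of `T` is `u ++ u'`, where `u'` is the first row of `T`
(so that `u` is the reading word of the remaining rows), then `K(T) = P(u' ++ u)`. -/
def K (T : Tableau) : Tableau := P (firstRow T ++ readingWord T.tail)

/-- `d(T)` is the largest `m` such that the first row of `T` contains `1, 2, …, m`. Such an `m`
is at most the length of the row; see `isGreatest_d`. -/
def d (T : Tableau) : ℕ :=
  Nat.findGreatest (fun m => ∀ j < m, j + 1 ∈ firstRow T) (firstRow T).length

theorem isGreatest_d (T : Tableau) :
    IsGreatest {m : ℕ | ∀ j, 1 ≤ j → j ≤ m → j ∈ firstRow T} (d T) := by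
  have key : ∀ m : ℕ, (∀ j < m, j + 1 ∈ firstRow T) ↔
      ∀ j, 1 ≤ j → j ≤ m → j ∈ firstRow T := by
    intro m
    constructor
    · intro h j h1 h2
      have h3 := h (j - 1) (by omega)
      rwa [Nat.sub_add_cancel h1] at h3
    · intro h j hj
      exact h (j + 1) (by omega) (by omega)
  constructor
  · exact (key _).1 (Nat.findGreatest_spec (P := fun m => ∀ j < m, j + 1 ∈ firstRow T)
      (Nat.zero_le _) (by simp))
  · intro m hm
    refine Nat.le_findGreatest (P := fun m => ∀ j < m, j + 1 ∈ firstRow T) ?_ ((key m).2 hm)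
    have h : Finset.Icc 1 m ⊆ (firstRow T).toFinset := fun j hj => by
      rw [Finset.mem_Icc] at hj
      exact List.mem_toFinset.2 (hm j hj.1 hj.2)
    have h2 := (Finset.card_le_card h).trans (List.toFinset_card_le _)
    simpa using h2

/-- The catabolizability type of a tableau, the sequence
`(d(T), d(K(T)) - d(T), …, d(K^i(T)) - d(K^(i-1)(T)), …)`, indexed from `0`. The differences are
taken in `ℤ`, so no subtraction is truncated. -/
def ctypeTableau (T : Tableau) : ℕ → ℤ
  | 0 => d T
  | i + 1 => (d (K^[i + 1] T) : ℤ) - d (K^[i] T)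

/-- The one-line notation `w₁ w₂ ⋯ wₙ` of a permutation, a word in the letters `1, …, n`. -/
def word {n : ℕ} (w : Equiv.Perm (Fin n)) : List ℕ := List.ofFn fun i => (w i : ℕ) + 1

/-- The catabolizability type of a permutation is that of its insertion tableau. -/
def ctype {n : ℕ} (w : Equiv.Perm (Fin n)) : ℕ → ℤ := ctypeTableau (P (word w))

/-- Dominance order, for partitions padded with zeros to infinite sequences:
`μ₁ + ⋯ + μₖ ≥ lam₁ + ⋯ + lamₖ` for all `k`. -/
def Dominates (μ lam : ℕ → ℤ) : Prop :=
  ∀ k : ℕ, ∑ i ∈ Finset.range k, lam i ≤ ∑ i ∈ Finset.range k, μ i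

end Catabolism

/-!
# Exchanging adjacent entries with a gap increases the catabolizability type

The partial sums of the type are the numbers `d (K^[k] (P w))`, so these have to be compared. A bound
`m ≤ d (K^[k] (P w))` means that after `k` catabolisms all letters at most `m` are in the first row
(`Catabolizable`). This is characterized by a condition on the word of those letters of `w` that are
at most `m`, in the manner of Greene's theorem, and the condition is visibly preserved by the
exchange.

The condition is the existence of a *certificate* of height `k`. A leveling `ℓ` of a word assigns
levels to its letters so that the word is the standardization of the word of levels. The word is
read from right to left, over and over again, and with each round all levels increase by `1`. Each
letter `x` is selected in one of the rounds, `t x`, hence at level `ℓ x + t x`. In a certificate,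
the levels in the order of selection form a ballot (Yamanouchi) sequence and do not exceed `k`.

* Certificates are invariant under Knuth equivalence (`IsCertificate.knuth`), because moving the
  letter of higher level to the left is harmless, and in the opposite direction two letters of equal
  level can exchange their rounds.
* If `u ++ v` is the reading word of a tableau with first row `v`, a certificate of height `k + 1`
  for `u ++ v` gives one of height `k` for `v ++ u` (`IsCertificate.catabolize`). So a certificate
  of height `k` implies catabolizability in `k` steps.
* Conversely, certificates can be lifted from `v ++ u` to `u ++ v`
  (`IsCertificate.of_catabolize`), provided that they are *normalized*: letters of level `0` are
  selected in round `0`. The lift is again normalized, so the existence of normalized certificates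
  follows by induction from catabolizability. That `v` has enough letters of level `0` for the lift
  comes from the strictly increasing columns (`IsTableau.countP_level_zero_le`).
* In a leveled word, adjacent letters `a`, `b` with `a + 1 < b` have different levels, because the
  letter `a + 1` occurs elsewhere. Exchanging them moves the higher level to the left and thus keeps
  the certificate (`Catabolizable.swap`).
-/

namespace Catabolism

/-! ### Levelings, selections and certificates -/

/-- A leveling of the word `w`: a weakly increasing function `ℓ` of the letters which is constant
only on letters that occur in `w` in increasing order. Thus `w` is the standardization of the word
`w.map ℓ`. -/
def IsLeveling (ℓ : ℕ → ℕ) (w : List ℕ) : Prop :=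
  w.Pairwise fun a b => (a < b → ℓ a ≤ ℓ b) ∧ (b < a → ℓ b < ℓ a)

/-- The word `w` is read from right to left in rounds `s = 0, 1, …`, and the letter `x` is selected
in round `t x`, at level `ℓ x + t x`. This is the number of letters at level `r` that have been
selected at the moment when, in round `s`, the suffix `v` of `w` has been read. -/
def selCount (ℓ t : ℕ → ℕ) (w v : List ℕ) (s r : ℕ) : ℕ :=
  w.countP (fun x => t x < s ∧ ℓ x + t x = r) + v.countP (fun x => t x = s ∧ ℓ x + t x = r)

/-- The levels of the selected letters, in the order of selection, form a ballot sequence: at no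
moment does a level occur more often than the level below it. -/
def IsBallot (ℓ t : ℕ → ℕ) (w : List ℕ) : Prop :=
  ∀ s v, v <:+ w → ∀ r, selCount ℓ t w v s (r + 1) ≤ selCount ℓ t w v s r

/-- A certificate of height `k` for `w`: a leveling and a ballot selection in which all letters are
selected at levels at most `k`. -/
structure IsCertificate (k : ℕ) (ℓ t : ℕ → ℕ) (w : List ℕ) : Prop where
  nodup : w.Nodup
  leveling : IsLeveling ℓ w
  ballot : IsBallot ℓ t w
  le : ∀ x ∈ w, ℓ x + t x ≤ k

/-- In a normalized certificate, letters of level `0` are selected in round `0`. -/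
def IsNormalized (ℓ t : ℕ → ℕ) (w : List ℕ) : Prop := ∀ x ∈ w, ℓ x = 0 → t x = 0

theorem suffix_append_cases {α : Type*} {v a b : List α} (h : v <:+ a ++ b) :
    v <:+ b ∨ ∃ a', a' <:+ a ∧ v = a' ++ b := by
  obtain ⟨c, hc⟩ := h
  rcases List.append_eq_append_iff.1 hc with ⟨d, rfl, rfl⟩ | ⟨d, rfl, rfl⟩
  · exact Or.inr ⟨d, ⟨c, rfl⟩, rfl⟩
  · exact Or.inl ⟨d, rfl⟩

theorem selCount_perm {ℓ t : ℕ → ℕ} {w w' v v' : List ℕ} (h : w.Perm w') (hv : v.Perm v')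
    (s r : ℕ) : selCount ℓ t w v s r = selCount ℓ t w' v' s r := by
  simp only [selCount, h.countP_eq, hv.countP_eq]

theorem perm_swap_mid {α : Type*} (p q : List α) (x y : α) :
    (p ++ x :: y :: q).Perm (p ++ y :: x :: q) :=
  (List.Perm.swap y x q).append_left p

/-- Exchanging adjacent letters `x`, `y` creates a single new moment of the selection in each
round: the one at which `x` has been read and `y` has not. -/
theorem IsBallot.swap_of_moment {ℓ t : ℕ → ℕ} {p q : List ℕ} {x y : ℕ}
    (h : IsBallot ℓ t (p ++ x :: y :: q))
    (hx : ∀ s r, selCount ℓ t (p ++ x :: y :: q) (x :: q) s (r + 1) ≤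
      selCount ℓ t (p ++ x :: y :: q) (x :: q) s r) :
    IsBallot ℓ t (p ++ y :: x :: q) := by
  intro s v hv r
  have key : ∀ v', v'.Perm v → (∀ r, selCount ℓ t (p ++ x :: y :: q) v' s (r + 1) ≤
      selCount ℓ t (p ++ x :: y :: q) v' s r) →
      selCount ℓ t (p ++ y :: x :: q) v s (r + 1) ≤ selCount ℓ t (p ++ y :: x :: q) v s r := by
    intro v' hp H
    rw [← selCount_perm (perm_swap_mid p q x y) hp, ← selCount_perm (perm_swap_mid p q x y) hp]
    exact H r
  rcases suffix_append_cases hv with hv | ⟨p', hp', rfl⟩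
  · rcases List.suffix_cons_iff.1 hv with rfl | hv
    · exact key (x :: y :: q) (List.Perm.swap y x q) (h s _ (List.suffix_append _ _))
    · rcases List.suffix_cons_iff.1 hv with rfl | hv
      · exact key _ (List.Perm.refl _) (hx s)
      · refine key v (List.Perm.refl _) (h s v ?_)
        exact hv.trans ⟨p ++ [x, y], by simp⟩
  · refine key (p' ++ x :: y :: q) (perm_swap_mid _ _ _ _) (h s _ ?_)
    obtain ⟨c, rfl⟩ := hp'
    exact ⟨c, by simp⟩

/-- Adjacent letters may be exchanged unless they are selected in the same round and the selection
of the left one may depend on the selection of the right one. -/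
theorem IsBallot.swap {ℓ t : ℕ → ℕ} {p q : List ℕ} {x y : ℕ}
    (h : IsBallot ℓ t (p ++ x :: y :: q)) (hxy : t x = t y → ℓ x ≠ ℓ y + 1) :
    IsBallot ℓ t (p ++ y :: x :: q) := by
  refine h.swap_of_moment fun s r => ?_
  have h1 := h s (x :: y :: q) (List.suffix_append _ _) r
  have h2 := h s q ⟨p ++ [x, y], by simp⟩ r
  simp only [selCount, List.countP_cons, decide_eq_true_eq] at h1 h2 ⊢
  split_ifs at h1 h2 ⊢ <;> omega

theorem IsBallot.comp {ℓ t : ℕ → ℕ} {σ : ℕ → ℕ} {w : List ℕ} (h : IsBallot ℓ t (w.map σ))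
    (hσ : ∀ x, ℓ (σ x) = ℓ x) : IsBallot ℓ (t ∘ σ) w := by
  intro s v hv r
  have := h s (v.map σ) (hv.map σ) r
  simpa only [selCount, List.countP_map, Function.comp_def, hσ] using this

theorem IsLeveling.swap {ℓ : ℕ → ℕ} {p q : List ℕ} {x y : ℕ}
    (h : IsLeveling ℓ (p ++ x :: y :: q)) (hxy : (y < x → ℓ y ≤ ℓ x) ∧ (x < y → ℓ x < ℓ y)) :
    IsLeveling ℓ (p ++ y :: x :: q) := by
  simp only [IsLeveling, List.pairwise_append, List.pairwise_cons, List.mem_cons] at h ⊢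
  grind

theorem IsLeveling.rel {ℓ : ℕ → ℕ} {p q r : List ℕ} {x y : ℕ}
    (h : IsLeveling ℓ (p ++ x :: q ++ y :: r)) : (x < y → ℓ x ≤ ℓ y) ∧ (y < x → ℓ y < ℓ x) := by
  simp only [IsLeveling, List.pairwise_append, List.pairwise_cons, List.mem_cons,
    List.mem_append] at h
  grind

/-- An exchange of adjacent letters that creates an inversion between different levels preserves
certificates: it moves the letter of higher level to the left, where it is read later. -/
theorem IsCertificate.swap {k : ℕ} {ℓ t : ℕ → ℕ} {p q : List ℕ} {x y : ℕ}
    (h : IsCertificate k ℓ t (p ++ x :: y :: q)) (hxy : x < y) (hl : ℓ x < ℓ y) :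
    IsCertificate k ℓ t (p ++ y :: x :: q) where
  nodup := (perm_swap_mid p q x y).nodup_iff.1 h.nodup
  leveling := h.leveling.swap ⟨fun h => by omega, fun _ => hl⟩
  ballot := h.ballot.swap fun _ => by omega
  le z hz := h.le z ((perm_swap_mid p q x y).mem_iff.2 hz)

theorem IsNormalized.perm {ℓ t : ℕ → ℕ} {w w' : List ℕ} (h : IsNormalized ℓ t w)
    (hw : w.Perm w') : IsNormalized ℓ t w' := fun x hx => h x (hw.mem_iff.2 hx)

/-! ### Knuth equivalence -/

/-- An elementary Knuth transformation, in the direction that creates an inversion. -/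
inductive KnuthStep : List ℕ → List ℕ → Prop
  | right (p q : List ℕ) {a b c : ℕ} (hab : a < b) (hbc : b ≤ c) :
    KnuthStep (p ++ b :: a :: c :: q) (p ++ b :: c :: a :: q)
  | left (p q : List ℕ) {a b c : ℕ} (hab : a ≤ b) (hbc : b < c) :
    KnuthStep (p ++ a :: c :: b :: q) (p ++ c :: a :: b :: q)

/-- Knuth equivalence of words. -/
def Knuth : List ℕ → List ℕ → Prop := Relation.EqvGen KnuthStep

theorem Knuth.refl (w : List ℕ) : Knuth w w := Relation.EqvGen.refl w

theorem Knuth.symm {w w' : List ℕ} (h : Knuth w w') : Knuth w' w := Relation.EqvGen.symm _ _ h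

theorem Knuth.trans {w w' w'' : List ℕ} (h : Knuth w w') (h' : Knuth w' w'') : Knuth w w'' :=
  Relation.EqvGen.trans _ _ _ h h'

theorem KnuthStep.knuth {w w' : List ℕ} (h : KnuthStep w w') : Knuth w w' :=
  Relation.EqvGen.rel _ _ h

theorem KnuthStep.append {w w' : List ℕ} (h : KnuthStep w w') (p q : List ℕ) :
    KnuthStep (p ++ w ++ q) (p ++ w' ++ q) := by
  cases h with
  | right p' q' hab hbc => simpa using KnuthStep.right (p ++ p') (q' ++ q) hab hbc
  | left p' q' hab hbc => simpa using KnuthStep.left (p ++ p') (q' ++ q) hab hbc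

theorem Knuth.append {w w' : List ℕ} (h : Knuth w w') (p q : List ℕ) :
    Knuth (p ++ w ++ q) (p ++ w' ++ q) := by
  induction h with
  | rel _ _ h => exact (h.append p q).knuth
  | refl => exact Knuth.refl _
  | symm _ _ _ ih => exact ih.symm
  | trans _ _ _ _ _ ih1 ih2 => exact ih1.trans ih2

theorem KnuthStep.perm {w w' : List ℕ} (h : KnuthStep w w') : w.Perm w' := by
  cases h with
  | right p q _ _ => exact ((List.Perm.swap _ _ q).cons _).append_left p
  | left p q _ _ => exact (List.Perm.swap _ _ _).append_left p

theorem Knuth.perm {w w' : List ℕ} (h : Knuth w w') : w.Perm w' := by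
  induction h with
  | rel _ _ h => exact h.perm
  | refl => exact List.Perm.refl _
  | symm _ _ _ ih => exact ih.symm
  | trans _ _ _ _ _ ih1 ih2 => exact ih1.trans ih2

/-- Knuth equivalence is compatible with restriction to the letters at most `m`. -/
theorem Knuth.filter_le {w w' : List ℕ} (h : Knuth w w') (m : ℕ) :
    Knuth (w.filter (· ≤ m)) (w'.filter (· ≤ m)) := by
  induction h with
  | rel _ _ h =>
    cases h with
    | @right p q a b c hab hbc =>
      by_cases hc : c ≤ m
      · have hb : b ≤ m := by omega
        have ha : a ≤ m := by omega
        simpa [List.filter_cons, ha, hb, hc] using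
          (KnuthStep.right (p.filter (· ≤ m)) (q.filter (· ≤ m)) hab hbc).knuth
      · simpa [List.filter_cons, hc] using Knuth.refl _
    | @left p q a b c hab hbc =>
      by_cases hc : c ≤ m
      · have hb : b ≤ m := by omega
        have ha : a ≤ m := by omega
        simpa [List.filter_cons, ha, hb, hc] using
          (KnuthStep.left (p.filter (· ≤ m)) (q.filter (· ≤ m)) hab hbc).knuth
      · simpa [List.filter_cons, hc] using Knuth.refl _
  | refl => exact Knuth.refl _
  | symm _ _ _ ih => exact ih.symm
  | trans _ _ _ _ _ ih1 ih2 => exact ih1.trans ih2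

/-! ### Certificates are invariant under Knuth equivalence -/

theorem swap_level {ℓ : ℕ → ℕ} {x y : ℕ} (h : ℓ x = ℓ y) (z : ℕ) :
    ℓ (Equiv.swap x y z) = ℓ z := by
  by_cases hx : z = x
  · subst hx; simp [h]
  · by_cases hy : z = y
    · subst hy; simp [h]
    · rw [Equiv.swap_apply_of_ne_of_ne hx hy]

theorem map_swap_of_notMem {x y : ℕ} {w : List ℕ} (hx : x ∉ w) (hy : y ∉ w) :
    w.map (Equiv.swap x y) = w := by
  refine (List.map_congr_left fun z hz => ?_).trans (List.map_id w)
  exact Equiv.swap_apply_of_ne_of_ne (fun e => hx (e ▸ hz)) (fun e => hy (e ▸ hz))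

/-- The inverse of an elementary Knuth transformation preserves certificates. If the selection does
not survive because the exchanged letters have consecutive levels and the same round, then the
third letter has the level of one of them, and the rounds of these two letters are exchanged. -/
theorem IsCertificate.of_knuthStep {k : ℕ} {ℓ t : ℕ → ℕ} {w w' : List ℕ}
    (h : IsCertificate k ℓ t w') (hs : KnuthStep w w') :
    ∃ t', IsCertificate k ℓ t' w ∧ (IsNormalized ℓ t w' → IsNormalized ℓ t' w) := by
  have hp := hs.perm
  have hnd := hp.nodup_iff.2 h.nodup
  suffices H : IsLeveling ℓ w ∧ (IsBallot ℓ t w ∨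
      ∃ x y, ℓ x = ℓ y ∧ x ∈ w ∧ y ∈ w ∧ IsBallot ℓ (t ∘ Equiv.swap x y) w) by
    obtain ⟨hl, hb | ⟨x, y, hxy, hx, hy, hb⟩⟩ := H
    · exact ⟨t, ⟨hnd, hl, hb, fun z hz => h.le z (hp.mem_iff.1 hz)⟩, fun hn => hn.perm hp.symm⟩
    · have hmem : ∀ z ∈ w, Equiv.swap x y z ∈ w' := by
        intro z hz
        rw [← hp.mem_iff]
        rw [Equiv.swap_apply_def]
        split_ifs <;> assumption
      refine ⟨_, ⟨hnd, hl, hb, fun z hz => ?_⟩, fun hn z hz h0 => ?_⟩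
      · have := h.le _ (hmem z hz)
        rwa [swap_level hxy] at this
      · exact hn _ (hmem z hz) (by rwa [swap_level hxy])
  cases hs with
  | @right p q a b c hab hbc =>
    have hne : b ≠ c := by
      rintro rfl
      simp [List.nodup_append] at hnd
    have h1 := (IsLeveling.rel (p := p) (q := []) (by simpa using h.leveling)).1
      (lt_of_le_of_ne hbc hne)
    have h2 := (IsLeveling.rel (p := p) (q := [c]) (x := b) (y := a) (r := q)
      (by simpa using h.leveling)).2 hab
    have hw : p ++ b :: c :: a :: q = (p ++ [b]) ++ c :: a :: q := by simp
    have hw' : p ++ b :: a :: c :: q = (p ++ [b]) ++ a :: c :: q := by simp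
    refine ⟨?_, ?_⟩
    · rw [hw']
      exact (hw ▸ h.leveling).swap ⟨fun _ => by omega, fun _ => by omega⟩
    by_cases h3 : t c = t a ∧ ℓ c = ℓ a + 1
    · by_cases h4 : t b = t c
      · left
        rw [hw']
        refine (hw ▸ h.ballot).swap_of_moment fun s r => ?_
        rw [← hw]
        have e1 := h.ballot s (b :: c :: a :: q) (List.suffix_append _ _) r
        have e2 := h.ballot s q ⟨p ++ [b, c, a], by simp⟩ r
        have e3 : ℓ b = ℓ c := by omega
        simp only [selCount, List.countP_cons, decide_eq_true_eq, h3.1, h3.2, h4, e3] at e1 e2 ⊢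
        split_ifs at e1 e2 ⊢ <;> omega
      · right
        refine ⟨b, c, by omega, by simp, by simp, IsBallot.comp ?_ (swap_level (by omega))⟩
        have e1 := h.ballot.swap (p := p) (x := b) (y := c) (fun e => absurd e h4)
        have e2 : IsBallot ℓ t ((p ++ [c]) ++ a :: b :: q) :=
          IsBallot.swap (by simpa using e1) (fun e => absurd (e.trans h3.1.symm) h4)
        simp only [List.nodup_append, List.nodup_cons, List.mem_cons] at hnd
        have e3 : (p ++ b :: a :: c :: q).map (Equiv.swap b c) = (p ++ [c]) ++ a :: b :: q := by
          rw [List.map_append, map_swap_of_notMem (by grind) (by grind)]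
          simp only [List.map_cons, Equiv.swap_apply_left, Equiv.swap_apply_right]
          rw [map_swap_of_notMem (by grind) (by grind),
            Equiv.swap_apply_of_ne_of_ne (by grind) (by grind)]
          simp
        rw [e3]
        exact e2
    · left
      rw [hw']
      exact (hw ▸ h.ballot).swap fun e e' => h3 ⟨e, e'⟩
  | @left p q a b c hab hbc =>
    have hne : a ≠ b := by
      rintro rfl
      simp [List.nodup_append] at hnd
    have h1 := (IsLeveling.rel (p := p ++ [c]) (q := []) (x := a) (y := b) (r := q)
      (by simpa using h.leveling)).1 (lt_of_le_of_ne hab hne)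
    have h2 := (IsLeveling.rel (p := p) (q := [a]) (x := c) (y := b) (r := q)
      (by simpa using h.leveling)).2 hbc
    refine ⟨h.leveling.swap ⟨fun _ => by omega, fun _ => by omega⟩, ?_⟩
    by_cases h3 : t c = t a ∧ ℓ c = ℓ a + 1
    · by_cases h4 : t a = t b
      · left
        refine h.ballot.swap_of_moment fun s r => ?_
        have e1 := h.ballot s (b :: q) ⟨p ++ [c, a], by simp⟩ r
        have e2 := h.ballot s q ⟨p ++ [c, a, b], by simp⟩ r
        have e3 : ℓ a = ℓ b := by omega
        simp only [selCount, List.countP_cons, decide_eq_true_eq, h3.1, h3.2, h4, e3] at e1 e2 ⊢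
        split_ifs at e1 e2 ⊢ <;> omega
      · right
        refine ⟨a, b, by omega, by simp, by simp, IsBallot.comp ?_ (swap_level (by omega))⟩
        have e1 : IsBallot ℓ t ((p ++ [c]) ++ b :: a :: q) :=
          IsBallot.swap (by simpa using h.ballot) (fun e => absurd e h4)
        have e2 := IsBallot.swap (p := p) (x := c) (y := b) (q := a :: q) (by simpa using e1)
          (fun e => absurd (h3.1.symm.trans e) h4)
        simp only [List.nodup_append, List.nodup_cons, List.mem_cons] at hnd
        have e3 : (p ++ a :: c :: b :: q).map (Equiv.swap a b) = p ++ b :: c :: a :: q := by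
          rw [List.map_append, map_swap_of_notMem (by grind) (by grind)]
          simp only [List.map_cons, Equiv.swap_apply_left, Equiv.swap_apply_right]
          rw [map_swap_of_notMem (by grind) (by grind),
            Equiv.swap_apply_of_ne_of_ne (by grind) (by grind)]
        rw [e3]
        exact e2
    · left
      exact h.ballot.swap fun e e' => h3 ⟨e, e'⟩

theorem IsCertificate.knuthStep {k : ℕ} {ℓ t : ℕ → ℕ} {w w' : List ℕ}
    (h : IsCertificate k ℓ t w) (hs : KnuthStep w w') : IsCertificate k ℓ t w' := by
  have hnd := h.nodup
  cases hs with
  | @right p q a b c hab hbc =>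
    have hne : b ≠ c := by
      rintro rfl
      simp [List.nodup_append] at hnd
    have h1 := (IsLeveling.rel (p := p) (q := [a]) (x := b) (y := c) (r := q)
      (by simpa using h.leveling)).1 (lt_of_le_of_ne hbc hne)
    have h2 := (IsLeveling.rel (p := p) (q := []) (x := b) (y := a) (r := c :: q)
      (by simpa using h.leveling)).2 hab
    simpa using IsCertificate.swap (p := p ++ [b]) (x := a) (y := c) (q := q)
      (by simpa using h) (by omega) (by omega)
  | @left p q a b c hab hbc =>
    have hne : a ≠ b := by
      rintro rfl
      simp [List.nodup_append] at hnd
    have h1 := (IsLeveling.rel (p := p) (q := [c]) (x := a) (y := b) (r := q)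
      (by simpa using h.leveling)).1 (lt_of_le_of_ne hab hne)
    have h2 := (IsLeveling.rel (p := p ++ [a]) (q := []) (x := c) (y := b) (r := q)
      (by simpa using h.leveling)).2 hbc
    exact h.swap (by omega) (by omega)

/-- The leveling itself does not change: only the selection does. -/
theorem IsCertificate.knuth {k : ℕ} {ℓ t : ℕ → ℕ} {w w' : List ℕ}
    (h : IsCertificate k ℓ t w) (hs : Knuth w w') :
    ∃ t', IsCertificate k ℓ t' w' ∧ (IsNormalized ℓ t w → IsNormalized ℓ t' w') := by
  suffices H : ∀ {w w' : List ℕ}, Knuth w w' →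
      (∀ t, IsCertificate k ℓ t w →
        ∃ t', IsCertificate k ℓ t' w' ∧ (IsNormalized ℓ t w → IsNormalized ℓ t' w')) ∧
      (∀ t, IsCertificate k ℓ t w' →
        ∃ t', IsCertificate k ℓ t' w ∧ (IsNormalized ℓ t w' → IsNormalized ℓ t' w)) from
    (H hs).1 t h
  intro w w' hs
  induction hs with
  | rel _ _ hs =>
    exact ⟨fun t h => ⟨t, h.knuthStep hs, fun hn => hn.perm hs.perm⟩,
      fun t h => h.of_knuthStep hs⟩
  | refl => exact ⟨fun t h => ⟨t, h, id⟩, fun t h => ⟨t, h, id⟩⟩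
  | symm _ _ _ ih => exact ih.symm
  | trans _ _ _ _ _ ih1 ih2 =>
    refine ⟨fun t h => ?_, fun t h => ?_⟩
    · obtain ⟨t1, h1, n1⟩ := ih1.1 t h
      obtain ⟨t2, h2, n2⟩ := ih2.1 t1 h1
      exact ⟨t2, h2, n2 ∘ n1⟩
    · obtain ⟨t1, h1, n1⟩ := ih2.2 t h
      obtain ⟨t2, h2, n2⟩ := ih1.2 t1 h1
      exact ⟨t2, h2, n2 ∘ n1⟩

/-! ### Row insertion and Knuth equivalence -/

theorem rowInsert_cons_of_lt {x y : ℕ} (h : x < y) (r : List ℕ) :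
    rowInsert x (y :: r) = (x :: r, some y) := by simp [rowInsert, h]

theorem rowInsert_cons_of_le {x y : ℕ} (h : y ≤ x) (r : List ℕ) :
    rowInsert x (y :: r) = (y :: (rowInsert x r).1, (rowInsert x r).2) := by
  simp [rowInsert, Nat.not_lt.2 h]

theorem mem_of_mem_rowInsert {x z : ℕ} {r : List ℕ} (h : z ∈ (rowInsert x r).1) :
    z = x ∨ z ∈ r := by
  induction r with
  | nil => simpa [rowInsert] using h
  | cons y r ih =>
    rcases lt_or_ge x y with hxy | hxy
    · rw [rowInsert_cons_of_lt hxy] at h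
      grind
    · rw [rowInsert_cons_of_le hxy] at h
      grind

theorem pairwise_rowInsert (x : ℕ) {r : List ℕ} (h : r.Pairwise (· ≤ ·)) :
    (rowInsert x r).1.Pairwise (· ≤ ·) := by
  induction r with
  | nil => simp [rowInsert]
  | cons y r ih =>
    rw [List.pairwise_cons] at h
    rcases lt_or_ge x y with hxy | hxy
    · rw [rowInsert_cons_of_lt hxy]
      exact List.pairwise_cons.2 ⟨fun z hz => hxy.le.trans (h.1 z hz), h.2⟩
    · rw [rowInsert_cons_of_le hxy]
      refine List.pairwise_cons.2 ⟨fun z hz => ?_, ih h.2⟩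
      rcases mem_of_mem_rowInsert hz with rfl | hz
      · exact hxy
      · exact h.1 z hz

theorem rowInsert_of_eq_none {x : ℕ} {r : List ℕ} (h : (rowInsert x r).2 = none) :
    (rowInsert x r).1 = r ++ [x] := by
  induction r with
  | nil => simp [rowInsert]
  | cons y r ih =>
    rcases lt_or_ge x y with hxy | hxy
    · simp [rowInsert_cons_of_lt hxy] at h
    · rw [rowInsert_cons_of_le hxy] at h ⊢
      simp [ih h]

theorem knuth_cons {w w' : List ℕ} (h : Knuth w w') (a : ℕ) : Knuth (a :: w) (a :: w') := by
  simpa using h.append [a] []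

/-- A letter smaller than a weakly increasing row moves to the second place of that row. -/
theorem knuth_append_of_lt {x a : ℕ} {r : List ℕ} (hx : x < a) (h : (a :: r).Pairwise (· ≤ ·)) :
    Knuth (a :: (r ++ [x])) (a :: x :: r) := by
  induction r generalizing a with
  | nil => exact Knuth.refl _
  | cons b r ih =>
    have hab : a ≤ b := (List.pairwise_cons.1 h).1 b (by simp)
    refine (knuth_cons (ih (by omega) (List.pairwise_cons.1 h).2) a).trans ?_
    exact (KnuthStep.right [] r hx hab).knuth.symm

/-- Row insertion of `x` that bumps `y` is a Knuth equivalence. -/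
theorem knuth_rowInsert {x y : ℕ} {r : List ℕ} (h : r.Pairwise (· ≤ ·))
    (hy : (rowInsert x r).2 = some y) : Knuth (r ++ [x]) (y :: (rowInsert x r).1) := by
  suffices H : Knuth (r ++ [x]) (y :: (rowInsert x r).1) ∧
      ∃ b r', (rowInsert x r).1 = b :: r' ∧ b < y ∧ x < y from H.1
  induction r with
  | nil => simp [rowInsert] at hy
  | cons a r ih =>
    rcases lt_or_ge x a with hxa | hxa
    · rw [rowInsert_cons_of_lt hxa] at hy ⊢
      obtain rfl : a = y := by simpa using hy
      exact ⟨knuth_append_of_lt hxa h, x, r, rfl, hxa, hxa⟩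
    · rw [rowInsert_cons_of_le hxa] at hy ⊢
      obtain ⟨hk, b, r', hr', hby, hxy⟩ := ih (List.pairwise_cons.1 h).2 hy
      have hab : a ≤ b := by
        rcases mem_of_mem_rowInsert (x := x) (z := b) (r := r) (by simp [hr']) with rfl | hb
        · exact hxa
        · exact (List.pairwise_cons.1 h).1 b hb
      refine ⟨(knuth_cons hk a).trans ?_, a, _, rfl, by omega, hxy⟩
      simp only [hr']
      exact (KnuthStep.left [] r' hab hby).knuth

/-! ### Tableaux -/

/-- The row `r'` may be placed on top of the row `r`: it is not longer than `r`, and each of its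
entries is larger than the entry of `r` in the same column. -/
def ColumnStrict : List ℕ → List ℕ → Prop
  | _, [] => True
  | [], _ :: _ => False
  | a :: r, b :: r' => a < b ∧ ColumnStrict r r'

/-- A semistandard tableau: rows weakly increase and columns strictly increase. -/
def IsTableau (T : Tableau) : Prop :=
  (∀ r ∈ T, r.Pairwise (· ≤ ·)) ∧ T.IsChain ColumnStrict

theorem columnStrict_nil (r : List ℕ) : ColumnStrict r [] := by
  cases r <;> trivial

theorem ColumnStrict.append_left {r r' : List ℕ} (h : ColumnStrict r r') (s : List ℕ) :
    ColumnStrict (r ++ s) r' := by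
  induction r generalizing r' with
  | nil => cases r' with
    | nil => exact columnStrict_nil _
    | cons b r' => exact h.elim
  | cons a r ih => cases r' with
    | nil => exact columnStrict_nil _
    | cons b r' => exact ⟨h.1, ih h.2⟩

/-- Row insertion with a bump decreases the entries of the row. -/
theorem ColumnStrict.rowInsert_left {r r' : List ℕ} (h : ColumnStrict r r') (x : ℕ) :
    ColumnStrict (rowInsert x r).1 r' := by
  induction r generalizing r' with
  | nil => cases r' with
    | nil => exact columnStrict_nil _
    | cons b r' => exact h.elim
  | cons a r ih => cases r' with
    | nil => exact columnStrict_nil _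
    | cons b r' =>
      rcases lt_or_ge x a with hxa | hxa
      · rw [rowInsert_cons_of_lt hxa]
        exact ⟨hxa.trans h.1, h.2⟩
      · rw [rowInsert_cons_of_le hxa]
        exact ⟨h.1, ih h.2⟩

theorem lt_of_rowInsert {x y : ℕ} {r : List ℕ} (hy : (rowInsert x r).2 = some y) : x < y := by
  induction r with
  | nil => simp [rowInsert] at hy
  | cons a r ih =>
    rcases lt_or_ge x a with hxa | hxa
    · rw [rowInsert_cons_of_lt hxa] at hy
      obtain rfl : a = y := by simpa using hy
      exact hxa
    · rw [rowInsert_cons_of_le hxa] at hy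
      exact ih hy

/-- Bumping paths move weakly to the left, so that columns stay strict. -/
theorem ColumnStrict.rowInsert_rowInsert {r r' : List ℕ} {x y : ℕ} (h : ColumnStrict r r')
    (hy : (rowInsert x r).2 = some y) :
    ColumnStrict (rowInsert x r).1 (rowInsert y r').1 := by
  induction r generalizing r' with
  | nil => simp [rowInsert] at hy
  | cons a r ih =>
    rcases lt_or_ge x a with hxa | hxa
    · rw [rowInsert_cons_of_lt hxa] at hy ⊢
      obtain rfl : a = y := by simpa using hy
      cases r' with
      | nil => exact ⟨hxa, columnStrict_nil _⟩
      | cons b r' =>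
        rw [rowInsert_cons_of_lt h.1]
        exact ⟨hxa, h.2⟩
    · rw [rowInsert_cons_of_le hxa] at hy ⊢
      have hxy := lt_of_rowInsert hy
      cases r' with
      | nil => exact ⟨by omega, columnStrict_nil _⟩
      | cons b r' =>
        rcases lt_or_ge y b with hyb | hyb
        · rw [rowInsert_cons_of_lt hyb]
          exact ⟨by omega, h.2.rowInsert_left x⟩
        · rw [rowInsert_cons_of_le hyb]
          exact ⟨h.1, ih h.2 hy⟩

theorem insert_cons_of_none {x : ℕ} {r : List ℕ} (h : (rowInsert x r).2 = none) (T : Tableau) :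
    insert (r :: T) x = (r ++ [x]) :: T := by
  have : rowInsert x r = (r ++ [x], none) := Prod.ext (rowInsert_of_eq_none h) h
  simp [insert, this]

theorem insert_cons_of_some {x y : ℕ} {r : List ℕ} (h : (rowInsert x r).2 = some y)
    (T : Tableau) : insert (r :: T) x = (rowInsert x r).1 :: insert T y := by
  have : rowInsert x r = ((rowInsert x r).1, some y) := Prod.ext rfl h
  rw [insert, this]

theorem readingWord_cons (r : List ℕ) (T : Tableau) :
    readingWord (r :: T) = readingWord T ++ r := by
  simp [readingWord]

theorem IsTableau.insert {T : Tableau} (h : IsTableau T) (x : ℕ) : IsTableau (insert T x) := by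
  induction T generalizing x with
  | nil => simp [Catabolism.insert, IsTableau]
  | cons r T ih =>
    obtain ⟨hr, hc⟩ := h
    simp only [List.forall_mem_cons] at hr
    rw [List.isChain_cons] at hc
    have hT : IsTableau T := ⟨hr.2, hc.2⟩
    cases hx : (rowInsert x r).2 with
    | none =>
      rw [insert_cons_of_none hx]
      refine ⟨?_, ?_⟩
      · simp only [List.forall_mem_cons]
        exact ⟨rowInsert_of_eq_none hx ▸ pairwise_rowInsert x hr.1, hr.2⟩
      · rw [List.isChain_cons]
        exact ⟨fun r' hr' => (hc.1 r' hr').append_left _, hc.2⟩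
    | some y =>
      rw [insert_cons_of_some hx]
      have hTy := ih hT y
      refine ⟨?_, ?_⟩
      · simp only [List.forall_mem_cons]
        exact ⟨pairwise_rowInsert x hr.1, hTy.1⟩
      · rw [List.isChain_cons]
        refine ⟨fun r' hr' => ?_, hTy.2⟩
        cases T with
        | nil =>
          obtain rfl : [y] = r' := by simpa [Catabolism.insert] using hr'
          exact (columnStrict_nil r).rowInsert_rowInsert hx
        | cons r₂ T =>
          have h₂ := (hc.1 r₂ (by simp)).rowInsert_rowInsert hx
          have h₃ := (hc.1 r₂ (by simp)).rowInsert_left x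
          cases hy : (rowInsert y r₂).2 with
          | none =>
            rw [insert_cons_of_none hy] at hr'
            obtain rfl : r₂ ++ [y] = r' := by simpa using hr'
            rwa [rowInsert_of_eq_none hy] at h₂
          | some z =>
            rw [insert_cons_of_some hy] at hr'
            obtain rfl : (rowInsert y r₂).1 = r' := by simpa using hr'
            exact h₂

theorem knuth_insert {T : Tableau} (h : IsTableau T) (x : ℕ) :
    Knuth (readingWord (insert T x)) (readingWord T ++ [x]) := by
  induction T generalizing x with
  | nil => simpa [insert, readingWord] using Knuth.refl _
  | cons r T ih =>
    have hr := h.1 r (by simp)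
    have hT : IsTableau T := ⟨fun r hr => h.1 r (by simp [hr]), h.2.of_cons⟩
    rw [readingWord_cons]
    cases hx : (rowInsert x r).2 with
    | none =>
      rw [insert_cons_of_none hx, readingWord_cons, List.append_assoc]
      exact Knuth.refl _
    | some y =>
      rw [insert_cons_of_some hx, readingWord_cons]
      refine ((ih hT y).append [] (rowInsert x r).1).trans ?_
      have := ((knuth_rowInsert hr hx).append (readingWord T) []).symm
      simpa using this

theorem isTableau_P_and_knuth (w : List ℕ) : IsTableau (P w) ∧ Knuth (readingWord (P w)) w := by
  induction w using List.reverseRecOn with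
  | nil => exact ⟨by simp [P, IsTableau], Knuth.refl _⟩
  | append_singleton w x ih =>
    have : P (w ++ [x]) = insert (P w) x := by simp [P]
    rw [this]
    refine ⟨ih.1.insert x, (knuth_insert ih.1 x).trans ?_⟩
    simpa using ih.2.append [] [x]

theorem isTableau_P (w : List ℕ) : IsTableau (P w) := (isTableau_P_and_knuth w).1

theorem knuth_readingWord_P (w : List ℕ) : Knuth (readingWord (P w)) w :=
  (isTableau_P_and_knuth w).2

theorem ColumnStrict.exists_lt {r r' : List ℕ} (h : ColumnStrict r r') {y : ℕ} (hy : y ∈ r') :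
    ∃ x ∈ r, x < y := by
  induction r generalizing r' with
  | nil => cases r' with
    | nil => simp at hy
    | cons b r' => exact h.elim
  | cons a r ih => cases r' with
    | nil => simp at hy
    | cons b r' =>
      rcases List.mem_cons.1 hy with rfl | hy
      · exact ⟨a, by simp, h.1⟩
      · obtain ⟨x, hx, hxy⟩ := ih h.2 hy
        exact ⟨x, by simp [hx], hxy⟩

theorem ColumnStrict.countP_le {r r' : List ℕ} (h : ColumnStrict r r') {p q : ℕ → Bool}
    (hpq : ∀ x ∈ r, ∀ y ∈ r', x < y → q y → p x) : r'.countP q ≤ r.countP p := by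
  induction r generalizing r' with
  | nil => cases r' with
    | nil => simp
    | cons b r' => exact h.elim
  | cons a r ih => cases r' with
    | nil => simp
    | cons b r' =>
      have h1 := ih h.2 fun x hx y hy => hpq x (by simp [hx]) y (by simp [hy])
      have h2 := hpq a (by simp) b (by simp) h.1
      simp only [List.countP_cons]
      split_ifs <;> first | omega | (simp_all)

/-- Every letter above the first row of a tableau exceeds some letter of the first row. -/
theorem IsTableau.exists_lt {r : List ℕ} {T : Tableau} (h : IsTableau (r :: T)) {y : ℕ}
    (hy : y ∈ readingWord T) : ∃ x ∈ r, x < y := by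
  induction T generalizing r with
  | nil => simp [readingWord] at hy
  | cons r' T ih =>
    have hT : IsTableau (r' :: T) := ⟨fun s hs => h.1 s (by simp [hs]), h.2.of_cons⟩
    have hc : ColumnStrict r r' := (List.isChain_cons.1 h.2).1 r' (by simp)
    rw [readingWord_cons, List.mem_append] at hy
    rcases hy with hy | hy
    · obtain ⟨z, hz, hzy⟩ := ih hT hy
      obtain ⟨x, hx, hxz⟩ := hc.exists_lt hz
      exact ⟨x, hx, hxz.trans hzy⟩
    · exact hc.exists_lt hy

/-- Let `T` be a tableau with first row `r`, and let the word obtained by catabolism be leveled.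
Then `r` has at least as many letters of level `0` as the other rows together: level `0` letters of
the other rows lie in the second row, and have a letter of level `0` below them. -/
theorem IsTableau.countP_level_zero_le {r : List ℕ} {T : Tableau} (h : IsTableau (r :: T))
    (m : ℕ) {ℓ : ℕ → ℕ}
    (hl : IsLeveling ℓ (r.filter (· ≤ m) ++ (readingWord T).filter (· ≤ m))) :
    ((readingWord T).filter (· ≤ m)).countP (ℓ · = 0) ≤ (r.filter (· ≤ m)).countP (ℓ · = 0) := by
  cases T with
  | nil => simp [readingWord]
  | cons r' T =>
    have hT : IsTableau (r' :: T) := ⟨fun s hs => h.1 s (by simp [hs]), h.2.of_cons⟩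
    have hc : ColumnStrict r r' := (List.isChain_cons.1 h.2).1 r' (by simp)
    simp only [readingWord_cons, List.filter_append, IsLeveling, List.pairwise_append] at hl
    obtain ⟨-, ⟨-, -, hl₁⟩, hl₂⟩ := hl
    simp only [List.mem_append, List.mem_filter, decide_eq_true_eq] at hl₁ hl₂
    rw [readingWord_cons, List.filter_append, List.countP_append]
    have h0 : ((readingWord T).filter (· ≤ m)).countP (ℓ · = 0) = 0 := by
      rw [List.countP_eq_zero]
      intro y hy
      simp only [List.mem_filter, decide_eq_true_eq] at hy ⊢
      obtain ⟨z, hz, hzy⟩ := hT.exists_lt hy.1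
      have := (hl₁ y hy z ⟨hz, by omega⟩).2 hzy
      omega
    rw [h0, Nat.zero_add, List.countP_filter, List.countP_filter]
    refine hc.countP_le fun x hx y hy hxy hq => ?_
    simp only [Bool.and_eq_true, decide_eq_true_eq] at hq ⊢
    have := (hl₂ x ⟨hx, by omega⟩ y (Or.inr ⟨hy, hq.2⟩)).1 hxy
    omega

/-! ### Certificates and catabolism -/

theorem countP_lt_add_countP_eq (f t : ℕ → ℕ) (w : List ℕ) (s r : ℕ) :
    w.countP (fun x => t x < s ∧ f x = r) + w.countP (fun x => t x = s ∧ f x = r) =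
      w.countP (fun x => t x < s + 1 ∧ f x = r) := by
  induction w with
  | nil => simp
  | cons a w ih =>
    simp only [List.countP_cons, decide_eq_true_eq]
    split_ifs <;> omega

theorem countP_le_of_suffix {v w : List ℕ} (h : v <:+ w) (p : ℕ → Bool) :
    v.countP p ≤ w.countP p := h.sublist.countP_le

theorem countP_le_of_imp {w : List ℕ} {p q : ℕ → Prop} [DecidablePred p] [DecidablePred q]
    (h : ∀ x ∈ w, p x → q x) :
    w.countP (fun x => decide (p x)) ≤ w.countP (fun x => decide (q x)) :=
  List.countP_mono_left fun x hx hp => by simpa using h x hx (by simpa using hp)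

theorem countP_eq_zero_of_not {w : List ℕ} {p : ℕ → Prop} [DecidablePred p]
    (h : ∀ x ∈ w, ¬ p x) : w.countP (fun x => decide (p x)) = 0 :=
  List.countP_eq_zero.2 fun x hx => by simpa using h x hx

/-- Levels weakly increase along a row. -/
theorem IsLeveling.pairwise_le {ℓ : ℕ → ℕ} {v : List ℕ} (h : IsLeveling ℓ v)
    (hv : v.Pairwise (· ≤ ·)) : v.Pairwise fun a b => ℓ a ≤ ℓ b := by
  refine (h.and hv).imp fun {a b} hab => ?_
  rcases hab.2.eq_or_lt with rfl | hlt
  · exact le_rfl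
  · exact hab.1.1 hlt

/-- In round `0` only the letters of level `0` of an increasing final segment are selected. -/
theorem IsBallot.level_eq_zero {ℓ t : ℕ → ℕ} {u v : List ℕ} (h : IsBallot ℓ t (u ++ v))
    (hv : v.Pairwise fun a b => ℓ a ≤ ℓ b) {x : ℕ} (hx : x ∈ v) (ht : t x = 0) : ℓ x = 0 := by
  by_contra h0
  obtain ⟨r, hr⟩ := Nat.exists_eq_succ_of_ne_zero h0
  obtain ⟨v₁, v₂, rfl⟩ := List.append_of_mem hx
  have h1 := h 0 (x :: v₂) ⟨u ++ v₁, by simp⟩ r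
  have h2 := (List.pairwise_cons.1 (List.pairwise_append.1 hv).2.1).1
  have h3 : (x :: v₂).countP (fun x => t x = 0 ∧ ℓ x + t x = r) = 0 := by
    refine countP_eq_zero_of_not fun y hy => ?_
    rcases List.mem_cons.1 hy with rfl | hy
    · omega
    · have := h2 y hy
      omega
  have h4 : 0 < (x :: v₂).countP (fun x => t x = 0 ∧ ℓ x + t x = r + 1) :=
    List.countP_pos_iff.2 ⟨x, by simp, by simp [ht, hr]⟩
  simp only [selCount, Nat.not_lt_zero, false_and, decide_false, List.countP_false] at h1
  omega

/-- Catabolism lowers the height of a certificate. Rotating the first row `v` to the left end of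
the word lowers the level of all other letters by `1`, and makes every letter of `v` that was not
selected in round `0` eligible one round earlier, so that all selected levels drop by `1`. The
letters selected in round `0` from `v` had level `0`; they keep it. -/
theorem IsCertificate.catabolize {k : ℕ} {ℓ t : ℕ → ℕ} {u v : List ℕ}
    (h : IsCertificate (k + 1) ℓ t (u ++ v)) (hv : v.Pairwise (· ≤ ·))
    (hu : ∀ y ∈ u, ∃ x ∈ v, x < y) : ∃ ℓ' t', IsCertificate k ℓ' t' (v ++ u) := by
  have hl := List.pairwise_append.1 h.leveling
  have hvl : v.Pairwise fun a b => ℓ a ≤ ℓ b := IsLeveling.pairwise_le hl.2.1 hv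
  have hdisj : ∀ x ∈ v, x ∉ u := fun x hx hx' => (List.nodup_append.1 h.nodup).2.2 x hx' x hx rfl
  have hu1 : ∀ y ∈ u, 0 < ℓ y := fun y hy => by
    obtain ⟨x, hx, hxy⟩ := hu y hy
    have := (hl.2.2 y hy x hx).2 hxy
    omega
  have hv0 : ∀ x ∈ v, t x = 0 → ℓ x = 0 := fun x hx => h.ballot.level_eq_zero hvl hx
  set ℓ' : ℕ → ℕ := fun x => if x ∈ u then ℓ x - 1 else ℓ x with hℓ'
  set t' : ℕ → ℕ := fun x => if x ∈ u then t x else t x - 1 with ht'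
  have eu : ∀ x ∈ u, ℓ' x = ℓ x - 1 ∧ t' x = t x := fun x hx => by simp [hℓ', ht', hx]
  have ev : ∀ x ∈ v, ℓ' x = ℓ x ∧ t' x = t x - 1 := fun x hx => by simp [hℓ', ht', hdisj x hx]
  clear_value ℓ' t'
  refine ⟨ℓ', t', (List.perm_append_comm.nodup_iff).1 h.nodup, ?_, ?_, ?_⟩
  · refine List.pairwise_append.2 ⟨hl.2.1.imp_of_mem ?_, hl.1.imp_of_mem ?_, ?_⟩
    · intro a b ha hb hab
      rwa [(ev a ha).1, (ev b hb).1]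
    · intro a b ha hb hab
      have := hu1 a ha
      have := hu1 b hb
      rw [(eu a ha).1, (eu b hb).1]
      omega
    · intro a ha b hb
      have := hl.2.2 b hb a ha
      have := hu1 b hb
      rw [(ev a ha).1, (eu b hb).1]
      omega
  · -- Each moment of the new selection corresponds to a moment of the old one.
    have key : ∀ s w, w <:+ v ++ u → ∃ s₀ w₀, w₀ <:+ u ++ v ∧ ∀ r,
        selCount ℓ' t' (v ++ u) w s (r + 1) ≤ selCount ℓ t (u ++ v) w₀ s₀ (r + 2) ∧
        selCount ℓ t (u ++ v) w₀ s₀ (r + 1) ≤ selCount ℓ' t' (v ++ u) w s r := by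
      have hvA : ∀ s r, v.countP (fun x => t' x < s ∧ ℓ' x + t' x = r + 1) ≤
          v.countP (fun x => t x < s + 1 ∧ ℓ x + t x = r + 2) := fun s r =>
        countP_le_of_imp fun x hx hp => by
          have := ev x hx
          have := hv0 x hx
          omega
      have hvB : ∀ s r, v.countP (fun x => t x < s + 1 ∧ ℓ x + t x = r + 1) ≤
          v.countP (fun x => t' x < s ∧ ℓ' x + t' x = r) := fun s r =>
        countP_le_of_imp fun x hx hp => by
          have := ev x hx
          have := hv0 x hx
          omega
      have huA : ∀ s r, u.countP (fun x => t' x < s ∧ ℓ' x + t' x = r) =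
          u.countP (fun x => t x < s ∧ ℓ x + t x = r + 1) := fun s r =>
        List.countP_congr fun x hx => by
          have := eu x hx
          have := hu1 x hx
          simp only [decide_eq_true_eq]
          omega
      intro s w hw
      rcases suffix_append_cases hw with hw | ⟨v', hv', rfl⟩
      · have hwB : ∀ r, w.countP (fun x => t' x = s ∧ ℓ' x + t' x = r) =
            w.countP (fun x => t x = s ∧ ℓ x + t x = r + 1) := fun r =>
          List.countP_congr fun x hx => by
            have := eu x (hw.subset hx)
            have := hu1 x (hw.subset hx)
            simp only [decide_eq_true_eq]
            omega
        refine ⟨s, w ++ v, ?_, fun r => ?_⟩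
        · obtain ⟨c, rfl⟩ := hw
          exact ⟨c, by simp⟩
        · simp only [selCount, List.countP_append, huA, hwB]
          have e1 := countP_lt_add_countP_eq (fun x => ℓ x + t x) t v s (r + 2)
          have e2 := countP_lt_add_countP_eq (fun x => ℓ x + t x) t v s (r + 1)
          have e3 := hvA s r
          have e4 := hvB s r
          simp only [Nat.add_assoc, Nat.reduceAdd] at e1 e2 e3 e4 ⊢
          omega
      · have hv'A : ∀ r, v'.countP (fun x => t' x = s ∧ ℓ' x + t' x = r + 1) ≤
            v'.countP (fun x => t x = s + 1 ∧ ℓ x + t x = r + 2) := fun r =>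
          countP_le_of_imp fun x hx hp => by
            have := ev x (hv'.subset hx)
            have := hv0 x (hv'.subset hx)
            omega
        have hv'B : ∀ r, v'.countP (fun x => t x = s + 1 ∧ ℓ x + t x = r + 1) ≤
            v'.countP (fun x => t' x = s ∧ ℓ' x + t' x = r) := fun r =>
          countP_le_of_imp fun x hx hp => by
            have := ev x (hv'.subset hx)
            omega
        refine ⟨s + 1, v', hv'.trans (List.suffix_append _ _), fun r => ?_⟩
        simp only [selCount, List.countP_append]
        have e1 := countP_lt_add_countP_eq (fun x => ℓ' x + t' x) t' u s (r + 1)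
        have e2 := countP_lt_add_countP_eq (fun x => ℓ' x + t' x) t' u s r
        have e3 := huA (s + 1) (r + 1)
        have e4 := huA (s + 1) r
        have e5 := hvA s r
        have e6 := hvB s r
        have e7 := hv'A r
        have e8 := hv'B r
        simp only [Nat.add_assoc, Nat.reduceAdd] at e1 e2 e3 e4 e5 e6 e7 e8 ⊢
        omega
    intro s w hw r
    obtain ⟨s₀, w₀, hw₀, H⟩ := key s w hw
    exact (H r).1.trans ((h.ballot s₀ w₀ hw₀ (r + 1)).trans (H r).2)
  · intro x hx
    rcases List.mem_append.1 hx with hx | hx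
    · have := ev x hx
      have := hv0 x hx
      have := h.le x (List.mem_append_right _ hx)
      omega
    · have := eu x hx
      have := hu1 x hx
      have := h.le x (List.mem_append_left _ hx)
      omega

/-- The letters of positive level of a row form a final segment. -/
theorem exists_suffix_pos {ℓ : ℕ → ℕ} {v : List ℕ} (hv : v.Pairwise fun a b => ℓ a ≤ ℓ b) :
    ∃ v', v' <:+ v ∧ (∀ x ∈ v', ℓ x ≠ 0) ∧
      ∀ p : ℕ → Bool, (∀ x, p x → ℓ x ≠ 0) → v'.countP p = v.countP p := by
  induction v with
  | nil => exact ⟨[], List.suffix_refl _, by simp, by simp⟩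
  | cons a v ih =>
    rw [List.pairwise_cons] at hv
    by_cases ha : ℓ a = 0
    · obtain ⟨v', h1, h2, h3⟩ := ih hv.2
      refine ⟨v', h1.trans (List.suffix_cons _ _), h2, fun p hp => ?_⟩
      have : ¬ p a := fun h => hp a h ha
      rw [h3 p hp, List.countP_cons_of_neg this]
    · refine ⟨a :: v, List.suffix_refl _, fun x hx => ?_, fun p _ => rfl⟩
      rcases List.mem_cons.1 hx with rfl | hx
      · exact ha
      · have := hv.1 x hx
        omega

/-- The converse of `IsCertificate.catabolize`, for normalized certificates. The letters of level
`0` of the row `v` are selected in round `0`; apart from this, the order of selection is kept and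
all levels grow by `1`. By normalization, level `1` of the given selection consists of letters read
in round `0` before the letters of level `0` of `v`, so the ballot condition does not need the
latter. -/
theorem IsCertificate.of_catabolize {k : ℕ} {ℓ t : ℕ → ℕ} {u v : List ℕ}
    (h : IsCertificate k ℓ t (v ++ u)) (hn : IsNormalized ℓ t (v ++ u))
    (hv : v.Pairwise (· ≤ ·)) (hz : u.countP (ℓ · = 0) ≤ v.countP (ℓ · = 0)) :
    ∃ ℓ' t', IsCertificate (k + 1) ℓ' t' (u ++ v) ∧ IsNormalized ℓ' t' (u ++ v) := by
  have hl := List.pairwise_append.1 h.leveling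
  have hvl : v.Pairwise fun a b => ℓ a ≤ ℓ b := IsLeveling.pairwise_le hl.1 hv
  have hdisj : ∀ x ∈ v, x ∉ u := fun x hx hx' => (List.nodup_append.1 h.nodup).2.2 x hx x hx' rfl
  have hnu : ∀ x ∈ u, ℓ x = 0 → t x = 0 := fun x hx => hn x (List.mem_append_right _ hx)
  have hnv : ∀ x ∈ v, ℓ x = 0 → t x = 0 := fun x hx => hn x (List.mem_append_left _ hx)
  -- The letters selected at level `1`, all of them in round `0`, are matched with zeros of `u`.
  have hones : u.countP (fun x => ℓ x = 1 ∧ t x = 0) + v.countP (fun x => ℓ x = 1 ∧ t x = 0) ≤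
      u.countP (ℓ · = 0) := by
    obtain ⟨v', h1, h2, h3⟩ := exists_suffix_pos hvl
    obtain ⟨c, hc⟩ := h1
    have e := h.ballot 0 (v' ++ u) ⟨c, by rw [← hc]; simp⟩ 0
    simp only [selCount, Nat.not_lt_zero, false_and, decide_false, List.countP_false,
      List.countP_append] at e
    have e1 : v'.countP (fun x => t x = 0 ∧ ℓ x + t x = 0) = 0 :=
      countP_eq_zero_of_not fun x hx => by
        have := h2 x hx
        omega
    have e2 : v.countP (fun x => ℓ x = 1 ∧ t x = 0) =
        v'.countP (fun x => ℓ x = 1 ∧ t x = 0) := by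
      refine (h3 _ fun x hx => ?_).symm
      simp only [decide_eq_true_eq] at hx
      omega
    have e3 : v'.countP (fun x => ℓ x = 1 ∧ t x = 0) ≤
        v'.countP (fun x => t x = 0 ∧ ℓ x + t x = 0 + 1) :=
      countP_le_of_imp fun x _ _ => by omega
    have e4 : u.countP (fun x => ℓ x = 1 ∧ t x = 0) ≤
        u.countP (fun x => t x = 0 ∧ ℓ x + t x = 0 + 1) :=
      countP_le_of_imp fun x _ _ => by omega
    have e5 : u.countP (fun x => t x = 0 ∧ ℓ x + t x = 0) ≤ u.countP (ℓ · = 0) :=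
      countP_le_of_imp fun x _ _ => by omega
    simp only [Nat.zero_add] at e e3 e4
    omega
  set ℓ' : ℕ → ℕ := fun x => if x ∈ u then ℓ x + 1 else ℓ x with hℓ'
  set t' : ℕ → ℕ := fun x => if x ∈ u then t x else if ℓ x = 0 then 0 else t x + 1 with ht'
  have eu : ∀ x ∈ u, ℓ' x = ℓ x + 1 ∧ t' x = t x := fun x hx => by simp [hℓ', ht', hx]
  have ev : ∀ x ∈ v, ℓ' x = ℓ x := fun x hx => by simp [hℓ', hdisj x hx]
  have ev0 : ∀ x ∈ v, ℓ x = 0 → t' x = 0 := fun x hx h0 => by simp [ht', hdisj x hx, h0]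
  have ev1 : ∀ x ∈ v, ℓ x ≠ 0 → t' x = t x + 1 := fun x hx h0 => by
    simp [ht', hdisj x hx, h0]
  clear_value ℓ' t'
  refine ⟨ℓ', t', ⟨(List.perm_append_comm.nodup_iff).1 h.nodup, ?_, ?_, ?_⟩, ?_⟩
  · refine List.pairwise_append.2 ⟨hl.2.1.imp_of_mem ?_, hl.1.imp_of_mem ?_, ?_⟩
    · intro a b ha hb hab
      rw [(eu a ha).1, (eu b hb).1]
      omega
    · intro a b ha hb hab
      rwa [ev a ha, ev b hb]
    · intro a ha b hb
      have := hl.2.2 b hb a ha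
      rw [(eu a ha).1, ev b hb]
      omega
  · have hu0 : ∀ s, u.countP (fun x => t' x < s ∧ ℓ' x + t' x = 1) ≤ u.countP (ℓ · = 0) :=
      fun s => countP_le_of_imp fun x hx hp => by
        have := eu x hx
        omega
    have hu0' : ∀ s, u.countP (ℓ · = 0) ≤
        u.countP (fun x => t' x < s + 1 ∧ ℓ' x + t' x = 1) :=
      fun s => countP_le_of_imp fun x hx hp => by
        have := eu x hx
        have := hnu x hx hp
        omega
    have hu1 : ∀ s, u.countP (fun x => t' x < s ∧ ℓ' x + t' x = 2) ≤
        u.countP (fun x => ℓ x = 1 ∧ t x = 0) :=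
      fun s => countP_le_of_imp fun x hx hp => by
        have := eu x hx
        have := hnu x hx
        omega
    have hv0 : ∀ s, v.countP (ℓ · = 0) ≤ v.countP (fun x => t' x < s + 1 ∧ ℓ' x + t' x = 0) :=
      fun s => countP_le_of_imp fun x hx hp => by
        have := ev x hx
        have := ev0 x hx hp
        omega
    have hv1 : ∀ s, v.countP (fun x => t' x < s ∧ ℓ' x + t' x = 1) = 0 :=
      fun s => countP_eq_zero_of_not fun x hx hp => by
        have := ev x hx
        have := ev0 x hx
        have := ev1 x hx
        omega
    have hv2 : ∀ s, v.countP (fun x => t' x < s ∧ ℓ' x + t' x = 2) ≤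
        v.countP (fun x => ℓ x = 1 ∧ t x = 0) :=
      fun s => countP_le_of_imp fun x hx hp => by
        have := ev x hx
        have := ev0 x hx
        have := ev1 x hx
        omega
    have hvA : ∀ s r, v.countP (fun x => t' x < s + 1 ∧ ℓ' x + t' x = r + 2) =
        v.countP (fun x => t x < s ∧ ℓ x + t x = r + 1) := fun s r =>
      List.countP_congr fun x hx => by
        have := ev x hx
        have := ev0 x hx
        have := ev1 x hx
        have := hnv x hx
        simp only [decide_eq_true_eq]
        omega
    have huA : ∀ s r, u.countP (fun x => t' x < s ∧ ℓ' x + t' x = r + 1) =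
        u.countP (fun x => t x < s ∧ ℓ x + t x = r) := fun s r =>
      List.countP_congr fun x hx => by
        have := eu x hx
        simp only [decide_eq_true_eq]
        omega
    have split_u' := fun s r => countP_lt_add_countP_eq (fun x => ℓ' x + t' x) t' u s r
    have split_v' := fun s r => countP_lt_add_countP_eq (fun x => ℓ' x + t' x) t' v s r
    have split_u := fun s r => countP_lt_add_countP_eq (fun x => ℓ x + t x) t u s r
    intro s w₀ hw₀ r
    simp only [selCount]
    rcases suffix_append_cases hw₀ with hw | ⟨w, hw, rfl⟩
    · have hwv := fun r => countP_le_of_suffix hw (fun x => t' x = s ∧ ℓ' x + t' x = r)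
      rcases s with _ | s
      · have hw0 : w₀.countP (fun x => t' x = 0 ∧ ℓ' x + t' x = r + 1) = 0 :=
          countP_eq_zero_of_not fun x hx hp => by
            have := ev x (hw.subset hx)
            have := ev0 x (hw.subset hx)
            have := ev1 x (hw.subset hx)
            omega
        rw [hw0]
        simp
      · simp only [List.countP_append]
        rcases r with _ | _ | r
        · have e1 := hwv 1
          have e2 := split_v' (s + 1) 1
          have e3 := hv1 (s + 1)
          have e4 := hv1 (s + 1 + 1)
          have e5 := hu0 (s + 1)
          have e6 := hv0 s
          simp only [Nat.zero_add]
          omega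
        · have e1 := hwv 2
          have e2 := split_v' (s + 1) 2
          have e3 := hv2 (s + 1 + 1)
          have e4 := hu1 (s + 1)
          have e5 := hu0' s
          simp only [Nat.zero_add, Nat.reduceAdd]
          omega
        · have hwA : ∀ r, w₀.countP (fun x => t' x = s + 1 ∧ ℓ' x + t' x = r + 2) =
              w₀.countP (fun x => t x = s ∧ ℓ x + t x = r + 1) := fun r =>
            List.countP_congr fun x hx => by
              have := ev x (hw.subset hx)
              have := ev0 x (hw.subset hx)
              have := ev1 x (hw.subset hx)
              have := hnv x (hw.subset hx)
              simp only [decide_eq_true_eq]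
              omega
          obtain ⟨c, hc⟩ := hw
          have e := h.ballot s (w₀ ++ u) ⟨c, by rw [← hc]; simp⟩ (r + 1)
          simp only [selCount, List.countP_append] at e
          have e1 := huA (s + 1) (r + 2)
          have e2 := huA (s + 1) (r + 1)
          have e3 := hvA s (r + 1)
          have e4 := hvA s r
          have e5 := hwA (r + 1)
          have e6 := hwA r
          have e7 := split_u s (r + 2)
          have e8 := split_u s (r + 1)
          simp only [Nat.add_assoc, Nat.reduceAdd] at e e1 e2 e3 e4 e5 e6 e7 e8 ⊢
          omega
    · have hwu := fun r => countP_le_of_suffix hw (fun x => t' x = s ∧ ℓ' x + t' x = r)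
      have hwB : ∀ r, w.countP (fun x => t' x = s ∧ ℓ' x + t' x = r + 1) =
          w.countP (fun x => t x = s ∧ ℓ x + t x = r) := fun r =>
        List.countP_congr fun x hx => by
          have := eu x (hw.subset hx)
          simp only [decide_eq_true_eq]
          omega
      simp only [List.countP_append]
      rcases r with _ | _ | r
      · have e1 := hwu 1
        have e2 := split_u' s 1
        have e3 := hu0 (s + 1)
        have e4 := split_v' s 1
        have e5 := hv1 (s + 1)
        have e6 := split_v' s 0
        have e7 := hv0 s
        simp only [Nat.zero_add]
        omega
      · rcases s with _ | s
        · have e := h.ballot 0 w (hw.trans (List.suffix_append _ _)) 0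
          simp only [selCount, Nat.not_lt_zero, false_and, decide_false, List.countP_false,
            Nat.zero_add] at e
          have e1 : v.countP (fun x => t' x = 0 ∧ ℓ' x + t' x = 2) = 0 :=
            countP_eq_zero_of_not fun x hx hp => by
              have := ev x hx
              have := ev0 x hx
              have := ev1 x hx
              omega
          have e2 := hwB 0
          have e3 := hwB 1
          simp only [Nat.not_lt_zero, false_and, decide_false, List.countP_false,
            Nat.zero_add, Nat.reduceAdd] at e1 e2 e3 ⊢
          omega
        · have e1 := hwu 2
          have e2 := split_u' (s + 1) 2
          have e3 := hu1 (s + 1 + 1)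
          have e4 := hu0' s
          have e5 := split_v' (s + 1) 2
          have e6 := hv2 (s + 1 + 1)
          simp only [Nat.zero_add, Nat.reduceAdd]
          omega
      · have e := h.ballot s w (hw.trans (List.suffix_append _ _)) (r + 1)
        simp only [selCount, List.countP_append] at e
        have e1 := huA s (r + 2)
        have e2 := huA s (r + 1)
        have e3 := hvA s (r + 1)
        have e4 := hvA s r
        have e5 := hwB (r + 2)
        have e6 := hwB (r + 1)
        have e7 := split_v' s (r + 3)
        have e8 := split_v' s (r + 2)
        simp only [Nat.add_assoc, Nat.reduceAdd] at e e1 e2 e3 e4 e5 e6 e7 e8 ⊢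
        omega
  · intro x hx
    rcases List.mem_append.1 hx with hx | hx
    · have := eu x hx
      have := h.le x (List.mem_append_right _ hx)
      omega
    · have := ev x hx
      have := ev0 x hx
      have := ev1 x hx
      have := h.le x (List.mem_append_left _ hx)
      omega
  · intro x hx h0
    rcases List.mem_append.1 hx with hx | hx
    · have := eu x hx
      omega
    · have := ev x hx
      exact ev0 x hx (by omega)

/-- After `k` catabolisms, all letters at most `m` of `T` are in the first row. -/
def Catabolizable (m k : ℕ) (T : Tableau) : Prop :=
  ∀ x ∈ readingWord T, x ≤ m → x ∈ firstRow (K^[k] T)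

theorem K_cons (r : List ℕ) (T : Tableau) : K (r :: T) = P (r ++ readingWord T) := rfl

theorem perm_readingWord_K (T : Tableau) : (readingWord (K T)).Perm (readingWord T) := by
  cases T with
  | nil => exact List.Perm.refl _
  | cons r T =>
    rw [K_cons, readingWord_cons]
    exact (knuth_readingWord_P _).perm.trans List.perm_append_comm

theorem catabolizable_succ {m k : ℕ} {T : Tableau} :
    Catabolizable m (k + 1) T ↔ Catabolizable m k (K T) := by
  simp only [Catabolizable, Function.iterate_succ_apply, (perm_readingWord_K T).mem_iff]

theorem IsCertificate.catabolizable {m k : ℕ} {T : Tableau} (hT : IsTableau T) {ℓ t : ℕ → ℕ}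
    (h : IsCertificate k ℓ t ((readingWord T).filter (· ≤ m))) : Catabolizable m k T := by
  induction k generalizing T ℓ t with
  | zero =>
    cases T with
    | nil => simp [Catabolizable, readingWord]
    | cons r T =>
      intro y hy hym
      rw [readingWord_cons] at hy h
      rcases List.mem_append.1 hy with hy | hy
      · -- All levels are `0`, so the restricted reading word increases.
        obtain ⟨x, hx, hxy⟩ := hT.exists_lt hy
        have hl := h.leveling
        rw [List.filter_append, IsLeveling, List.pairwise_append] at hl
        have h1 := (hl.2.2 y (by simp [hy, hym]) x (by simp [hx]; omega)).2 hxy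
        have h2 := h.le y (by simp [hy, hym])
        omega
      · exact hy
  | succ k ih =>
    rw [catabolizable_succ]
    cases T with
    | nil =>
      intro x hx
      simp [K, P, readingWord, firstRow] at hx
    | cons r T =>
      rw [readingWord_cons, List.filter_append] at h
      obtain ⟨ℓ', t', h'⟩ := h.catabolize ((hT.1 r (by simp)).filter _) fun y hy => by
        simp only [List.mem_filter, decide_eq_true_eq] at hy
        obtain ⟨x, hx, hxy⟩ := hT.exists_lt hy.1
        exact ⟨x, by simp [hx]; omega, hxy⟩
      rw [← List.filter_append] at h'
      obtain ⟨t'', h'', -⟩ := h'.knuth ((knuth_readingWord_P _).filter_le m).symm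
      rw [K_cons]
      exact ih (isTableau_P _) h''

theorem Catabolizable.exists_isCertificate {m k : ℕ} {T : Tableau} (hT : IsTableau T)
    (hnd : (readingWord T).Nodup) (h : Catabolizable m k T) :
    ∃ ℓ t, IsCertificate k ℓ t ((readingWord T).filter (· ≤ m)) ∧
      IsNormalized ℓ t ((readingWord T).filter (· ≤ m)) := by
  induction k generalizing T with
  | zero =>
    have hsub : ((readingWord T).filter (· ≤ m)).Sublist (firstRow T) := by
      cases T with
      | nil => simp [readingWord]
      | cons r T =>
        rw [readingWord_cons] at hnd
        rw [readingWord_cons, List.filter_append]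
        have h1 : (readingWord T).filter (· ≤ m) = [] := by
          refine List.filter_eq_nil_iff.2 fun x hx hxm => ?_
          refine (List.nodup_append.1 hnd).2.2 x hx x ?_ rfl
          exact h x (by rw [readingWord_cons]; simp [hx]) (by simpa using hxm)
        rw [h1]
        exact List.filter_sublist
    have hs : (firstRow T).Pairwise (· ≤ ·) := by
      cases T with
      | nil => simp [firstRow]
      | cons r T => exact hT.1 r (by simp)
    refine ⟨fun _ => 0, fun _ => 0, ⟨hnd.filter _, ?_, ?_, by simp⟩, by simp [IsNormalized]⟩
    · exact (hs.sublist hsub).imp fun {a b} hab => ⟨fun _ => le_rfl, fun h => by omega⟩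
    · intro s v _ r
      simp [selCount]
  | succ k ih =>
    rw [catabolizable_succ] at h
    cases T with
    | nil =>
      refine ⟨fun _ => 0, fun _ => 0, ⟨by simp [readingWord], by simp [readingWord, IsLeveling],
        fun s v _ r => by simp [selCount], by simp⟩, by simp [IsNormalized]⟩
    | cons r T =>
      obtain ⟨ℓ, t, hc, hn⟩ := ih (isTableau_P _) ((perm_readingWord_K (r :: T)).nodup_iff.2 hnd) h
      obtain ⟨t', hc', hn'⟩ := hc.knuth ((knuth_readingWord_P _).filter_le m)
      have hn'' := hn' hn
      rw [List.filter_append] at hc' hn''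
      rw [readingWord_cons, List.filter_append]
      exact hc'.of_catabolize hn'' ((hT.1 r (by simp)).filter _)
        (hT.countP_level_zero_le m hc'.leveling)

/-- The condition `a + 1 < b` on the exchanged letters is used here: if all letters between `a` and
`b` occur, then one of them forces `a` and `b` to have different levels. -/
theorem IsLeveling.lt_of_between {ℓ : ℕ → ℕ} {p q : List ℕ} {a b c : ℕ}
    (h : IsLeveling ℓ (p ++ a :: b :: q)) (hac : a < c) (hcb : c < b) (hc : c ∈ p ++ q) :
    ℓ a < ℓ b := by
  simp only [IsLeveling, List.pairwise_append, List.pairwise_cons, List.mem_cons] at h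
  rcases List.mem_append.1 hc with hc | hc
  · have h1 := (h.2.2 c hc a (by simp)).2 hac
    have h2 := (h.2.2 c hc b (by simp)).1 hcb
    omega
  · have h1 := (h.2.1.1 c (by simp [hc])).1 hac
    have h2 := (h.2.1.2.1 c hc).2 hcb
    omega

/-- Exchanging adjacent letters `a`, `b` with `a < c < b` for another letter `c` of the word
preserves catabolizability of the insertion tableau. -/
theorem Catabolizable.swap {m k : ℕ} {p q : List ℕ} {a b c : ℕ}
    (hnd : (p ++ a :: b :: q).Nodup) (hac : a < c) (hcb : c < b) (hc : c ∈ p ++ q)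
    (h : Catabolizable m k (P (p ++ a :: b :: q))) :
    Catabolizable m k (P (p ++ b :: a :: q)) := by
  obtain ⟨ℓ, t, hC, -⟩ := h.exists_isCertificate (isTableau_P _)
    ((knuth_readingWord_P _).perm.nodup_iff.2 hnd)
  obtain ⟨t', hC', -⟩ := hC.knuth ((knuth_readingWord_P _).filter_le m)
  have hC'' : IsCertificate k ℓ t' ((p ++ b :: a :: q).filter (· ≤ m)) := by
    by_cases hb : b ≤ m
    · have ha : a ≤ m := by omega
      have hcm : c ≤ m := by omega
      simp only [List.filter_append, List.filter_cons, ha, hb, decide_true, if_true] at hC' ⊢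
      refine hC'.swap (hac.trans hcb) (hC'.leveling.lt_of_between hac hcb ?_)
      rw [← List.filter_append]
      simp [hcm, List.mem_append.1 hc]
    · simpa [List.filter_cons, hb] using hC'
  obtain ⟨t'', h'', -⟩ := hC''.knuth ((knuth_readingWord_P _).filter_le m).symm
  exact h''.catabolizable (isTableau_P _)

/-! ### Permutations -/

theorem le_d_iff {T : Tableau} {m : ℕ} :
    m ≤ d T ↔ ∀ j, 1 ≤ j → j ≤ m → j ∈ firstRow T := by
  refine ⟨fun h j h1 h2 => (isGreatest_d T).1 j h1 (h2.trans h), fun h => (isGreatest_d T).2 h⟩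

theorem mem_readingWord_of_mem_firstRow {T : Tableau} {x : ℕ} (h : x ∈ firstRow T) :
    x ∈ readingWord T := by
  cases T with
  | nil => simp [firstRow] at h
  | cons r T => rw [readingWord_cons]; exact List.mem_append_right _ h

theorem perm_readingWord_iterate_K (k : ℕ) (T : Tableau) :
    (readingWord (K^[k] T)).Perm (readingWord T) := by
  induction k generalizing T with
  | zero => exact List.Perm.refl _
  | succ k ih => exact (ih (K T)).trans (perm_readingWord_K T)

/-- For words in positive letters, a lower bound for `d` is a statement on catabolizability. -/
theorem le_d_iterate_K_iff {w : List ℕ} (hw : ∀ x ∈ w, 1 ≤ x) {m k : ℕ} :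
    m ≤ d (K^[k] (P w)) ↔ (∀ j, 1 ≤ j → j ≤ m → j ∈ w) ∧ Catabolizable m k (P w) := by
  have h1 := (perm_readingWord_iterate_K k (P w)).trans (knuth_readingWord_P w).perm
  have h2 := (knuth_readingWord_P w).perm
  rw [le_d_iff]
  constructor
  · intro h
    refine ⟨fun j hj hjm => ?_, fun x hx hxm => h x (hw x (h2.mem_iff.1 hx)) hxm⟩
    exact h1.mem_iff.1 (mem_readingWord_of_mem_firstRow (h j hj hjm))
  · rintro ⟨h, hc⟩ j hj hjm
    exact hc j (h2.mem_iff.2 (h j hj hjm)) hjm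

theorem sum_ctypeTableau (T : Tableau) (k : ℕ) :
    ∑ i ∈ Finset.range (k + 1), ctypeTableau T i = d (K^[k] T) := by
  induction k with
  | zero => simp [ctypeTableau]
  | succ k ih => rw [Finset.sum_range_succ, ih]; simp only [ctypeTableau]; ring

theorem dominates_of_forall_d_le {T T' : Tableau} (h : ∀ k, d (K^[k] T) ≤ d (K^[k] T')) :
    Dominates (ctypeTableau T') (ctypeTableau T) := by
  intro k
  cases k with
  | zero => simp
  | succ k =>
    rw [sum_ctypeTableau, sum_ctypeTableau]
    exact_mod_cast h k

theorem nodup_word {n : ℕ} (w : Equiv.Perm (Fin n)) : (word w).Nodup := by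
  refine List.nodup_ofFn.2 fun i j hij => w.injective (Fin.ext ?_)
  simpa using hij

theorem mem_word {n : ℕ} (w : Equiv.Perm (Fin n)) {x : ℕ} : x ∈ word w ↔ 1 ≤ x ∧ x ≤ n := by
  simp only [word, List.mem_ofFn]
  constructor
  · rintro ⟨i, rfl⟩
    omega
  · rintro ⟨h1, h2⟩
    exact ⟨w.symm ⟨x - 1, by omega⟩, by simp; omega⟩

/-- A list with at least `i + 2` entries, split at its entries in positions `i` and `i + 1`. -/
theorem eq_take_append_drop {α : Type*} (l : List α) (i : ℕ) (hi : i + 1 < l.length) :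
    l = l.take i ++ l[i] :: l[i + 1] :: l.drop (i + 2) := by
  rw [List.getElem_cons_drop, List.getElem_cons_drop, List.take_append_drop]

theorem exists_word_swap {n : ℕ} (w : Equiv.Perm (Fin n)) (i : ℕ) (hi : i + 1 < n) :
    ∃ p q, word w = p ++ ((w ⟨i, Nat.lt_of_succ_lt hi⟩ : ℕ) + 1) ::
        ((w ⟨i + 1, hi⟩ : ℕ) + 1) :: q ∧
      word (w * Equiv.swap ⟨i, Nat.lt_of_succ_lt hi⟩ ⟨i + 1, hi⟩) =
        p ++ ((w ⟨i + 1, hi⟩ : ℕ) + 1) :: ((w ⟨i, Nat.lt_of_succ_lt hi⟩ : ℕ) + 1) :: q := by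
  set w' := w * Equiv.swap ⟨i, Nat.lt_of_succ_lt hi⟩ ⟨i + 1, hi⟩ with hw'
  have hlen : ∀ v : Equiv.Perm (Fin n), (word v).length = n := fun v => by simp [word]
  have hget : ∀ j (hj : j < n), j ≠ i → j ≠ i + 1 → w' ⟨j, hj⟩ = w ⟨j, hj⟩ := by
    intro j hj h1 h2
    rw [hw', Equiv.Perm.mul_apply, Equiv.swap_apply_of_ne_of_ne]
    · simpa using h1
    · simpa using h2
  refine ⟨(word w).take i, (word w).drop (i + 2), ?_, ?_⟩
  · have := eq_take_append_drop (word w) i (by rw [hlen]; exact hi)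
    simpa [word] using this
  · have h := eq_take_append_drop (word w') i (by rw [hlen]; exact hi)
    have h1 : (word w').take i = (word w).take i := by
      refine List.ext_getElem (by simp [hlen]) fun j hj _ => ?_
      have hj' : j < i := by
        simp only [List.length_take, hlen] at hj
        omega
      simp [word, hget j (by omega) (by omega) (by omega)]
    have h2 : (word w').drop (i + 2) = (word w).drop (i + 2) := by
      refine List.ext_getElem (by simp [hlen]) fun j hj _ => ?_
      simp only [List.length_drop, hlen] at hj
      simp [word, hget (i + 2 + j) (by omega) (by omega) (by omega)]
    rw [h1, h2] at h
    have h3 : w' ⟨i, Nat.lt_of_succ_lt hi⟩ = w ⟨i + 1, hi⟩ := by simp [hw']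
    have h4 : w' ⟨i + 1, hi⟩ = w ⟨i, Nat.lt_of_succ_lt hi⟩ := by simp [hw']
    have h5 : ∀ j (hj : j < (word w').length),
        (word w')[j] = (w' ⟨j, by rwa [hlen] at hj⟩ : ℕ) + 1 := fun j hj => by simp [word]
    rw [h5, h5, h3, h4] at h
    exact h

end Catabolism

theorem mainTheorem5 (n : ℕ) (w : Equiv.Perm (Fin n)) (i : ℕ) (hi : i + 1 < n)
    (hw : (w ⟨i, Nat.lt_of_succ_lt hi⟩ : ℕ) + 1 < (w ⟨i + 1, hi⟩ : ℕ)) :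
    Catabolism.Dominates
      (Catabolism.ctype (w * Equiv.swap ⟨i, Nat.lt_of_succ_lt hi⟩ ⟨i + 1, hi⟩))
      (Catabolism.ctype w) := by
  obtain ⟨p, q, h1, h2⟩ := Catabolism.exists_word_swap w i hi
  refine Catabolism.dominates_of_forall_d_le fun k => le_of_forall_le fun m hm => ?_
  have hpos : ∀ v : Equiv.Perm (Fin n), ∀ x ∈ Catabolism.word v, 1 ≤ x :=
    fun v x hx => ((Catabolism.mem_word v).1 hx).1
  obtain ⟨h3, h4⟩ := (Catabolism.le_d_iterate_K_iff (hpos w)).1 hm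
  refine (Catabolism.le_d_iterate_K_iff (hpos _)).2 ⟨fun j hj hjm => ?_, ?_⟩
  · exact (Catabolism.mem_word _).2 ((Catabolism.mem_word w).1 (h3 j hj hjm))
  -- Letters of `word` are shifted by `1`; this is the successor of the first exchanged letter.
  have hc := (Catabolism.mem_word w (x := (w ⟨i, Nat.lt_of_succ_lt hi⟩ : ℕ) + 2)).2
    ⟨by omega, by omega⟩
  rw [h1] at h4 hc
  rw [h2]
  refine h4.swap (h1 ▸ Catabolism.nodup_word w) (Nat.lt_succ_self _) (by omega) ?_
  simp only [List.mem_append, List.mem_cons] at hc ⊢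
  rcases hc with hc | hc | hc | hc
  · exact Or.inl hc
  · omega
  · omega
  · exact Or.inr hc
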